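/- For a Boolean function $f:\{0,1\}^n\times\{0,1\}^n\to\{0,1\}$, let $D(f)$ be its deterministic two-party communication complexity (the minimum height of a deterministic protocol tree computing $f$, where Alice holds $x$, Bob holds $y$, each internal node is a bit sent by one of them, and each leaf carries the output), and let $R_2^{pub}(f)$ be its public-coin randomized communication complexity: the minimum $c$ such that some probability distribution over deterministic protocols of cost at most $c$ outputs $f(x,y)$ with probability at least $2/3$ on every input $(x,y)$. Theorem. There is an absolute constant $C>0$ such that for every $n\ge 2$ and every symmetric $g:\{0,1\}^n\to\{0,1\}$ (that is, $g(z)$ depends only on the Hamming weight of $z$), the function $f(x,y)=g(x\wedge y)$, where $\wedge$ is the bitwise AND, satisfies $$D(f)\le C\cdot R_2^{pub}(f)\cdot\log_2 n .$$ In other words, $D(f)\in O(R_2^{pub}(f)\log n)$, uniformly over all symmetric $g$. -/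

import Mathlib

/-- A deterministic two-party communication protocol on inputs in `X × Y`: a binary tree whose
internal nodes are owned by Alice or by Bob; the owner of a node sends one bit depending on her
or his own input, and the run continues in the first subtree if that bit is `true` and in the
second one if it is `false`. Each leaf carries the output bit, which both parties then know. -/
inductive CommProtocol (X Y : Type*) where
  | leaf (b : Bool) : CommProtocol X Y
  | alice (a : X → Bool) (P Q : CommProtocol X Y) : CommProtocol X Y
  | bob (b : Y → Bool) (P Q : CommProtocol X Y) : CommProtocol X Y

namespace CommProtocol

/-- The output of the protocol on input `(x, y)`. -/
def eval {X Y : Type*} : CommProtocol X Y → X → Y → Bool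
  | leaf b, _, _ => b
  | alice a P Q, x, y => if a x = true then P.eval x y else Q.eval x y
  | bob b P Q, x, y => if b y = true then P.eval x y else Q.eval x y

/-- The cost of a deterministic protocol: the height of the tree, i.e. the worst-case number of
bits that are exchanged. -/
def cost {X Y : Type*} : CommProtocol X Y → ℕ
  | leaf _ => 0
  | alice _ P Q => max P.cost Q.cost + 1
  | bob _ P Q => max P.cost Q.cost + 1

/-- The protocol computes `f` exactly, on every input. -/
def Computes {X Y : Type*} (P : CommProtocol X Y) (f : X → Y → Bool) : Prop :=
  ∀ x y, P.eval x y = f x y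

end CommProtocol

/-- A public-coin randomized protocol is a probability distribution over deterministic
protocols. Its cost is at most `c` if every protocol that occurs with positive probability has
cost at most `c`. -/
def PublicCoinCostLE {X Y : Type*} (μ : PMF (CommProtocol X Y)) (c : ℕ) : Prop :=
  ∀ P ∈ μ.support, P.cost ≤ c

/-- The public-coin protocol `μ` computes `f` with two-sided bounded error: on every input the
output equals `f x y` with probability at least `2 / 3`. -/
def PublicCoinComputes {X Y : Type*} (μ : PMF (CommProtocol X Y)) (f : X → Y → Bool) : Prop :=
  ∀ x y, (2 / 3 : ENNReal) ≤ (μ.map fun P => P.eval x y) (f x y)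

/-- The deterministic communication complexity `D(f)`. -/
noncomputable def detCC {X Y : Type*} (f : X → Y → Bool) : ℕ :=
  sInf {c | ∃ P : CommProtocol X Y, P.Computes f ∧ P.cost ≤ c}

/-- The two-sided bounded-error public-coin randomized communication complexity
`R₂^pub(f)`. -/
noncomputable def pubRandCC {X Y : Type*} (f : X → Y → Bool) : ℕ :=
  sInf {c | ∃ μ : PMF (CommProtocol X Y), PublicCoinComputes μ f ∧ PublicCoinCostLE μ c}

/-- Every function on a finite set of inputs of Alice has a deterministic protocol. -/
theorem exists_commProtocol_computes {X Y : Type*} [Finite X] (f : X → Y → Bool) :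
    ∃ P : CommProtocol X Y, P.Computes f := by
  classical
  cases nonempty_fintype X
  have key : ∀ s : Finset X, ∃ P : CommProtocol X Y, ∀ x ∈ s, ∀ y, P.eval x y = f x y := by
    intro s
    induction s using Finset.induction_on with
    | empty => exact ⟨.leaf true, by simp⟩
    | insert a s _ ih =>
      obtain ⟨P, hP⟩ := ih
      refine ⟨.alice (fun x => decide (x = a)) (.bob (f a) (.leaf true) (.leaf false)) P, ?_⟩
      intro x hx y
      by_cases hxa : x = a
      · subst hxa
        cases h : f x y <;> simp [CommProtocol.eval, h]
      · simpa [CommProtocol.eval, hxa] using hP x (Finset.mem_of_mem_insert_of_ne hx hxa) y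
  obtain ⟨P, hP⟩ := key Finset.univ
  exact ⟨P, fun x y => hP x (Finset.mem_univ x) y⟩

/-- For finite `X` the minimum in the definition of `detCC` is attained. -/
theorem detCC_spec {X Y : Type*} [Finite X] (f : X → Y → Bool) :
    ∃ P : CommProtocol X Y, P.Computes f ∧ P.cost ≤ detCC f := by
  obtain ⟨P, hP⟩ := exists_commProtocol_computes f
  exact Nat.sInf_mem (s := {c | ∃ P : CommProtocol X Y, P.Computes f ∧ P.cost ≤ c})
    ⟨P.cost, P, hP, le_rfl⟩

/-- For finite `X` the minimum in the definition of `pubRandCC` is attained. -/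
theorem pubRandCC_spec {X Y : Type*} [Finite X] (f : X → Y → Bool) :
    ∃ μ : PMF (CommProtocol X Y), PublicCoinComputes μ f ∧ PublicCoinCostLE μ (pubRandCC f) := by
  obtain ⟨P, hP⟩ := exists_commProtocol_computes f
  refine Nat.sInf_mem
    (s := {c | ∃ μ : PMF (CommProtocol X Y), PublicCoinComputes μ f ∧ PublicCoinCostLE μ c})
    ⟨P.cost, PMF.pure P, fun x y => ?_, fun Q hQ => ?_⟩
  · rw [PMF.pure_map, hP x y, PMF.pure_apply, if_pos rfl]
    exact ENNReal.div_le_of_le_mul (by norm_num)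
  · rw [PMF.support_pure, Set.mem_singleton_iff] at hQ
    rw [hQ]

/-- The Hamming weight `|x|` of a bit string. -/
def hammingWeight {n : ℕ} (x : Fin n → Bool) : ℕ :=
  (Finset.univ.filter fun i => x i = true).card

/-- A Boolean function is symmetric if its value depends only on the Hamming weight. -/
def IsSymmetricBoolFun {n : ℕ} (g : (Fin n → Bool) → Bool) : Prop :=
  ∀ x x' : Fin n → Bool, hammingWeight x = hammingWeight x' → g x = g x'

/-- The two-party function `f(x, y) = g(x ∧ y)`, with the bitwise AND. -/
def andFun {n : ℕ} (g : (Fin n → Bool) → Bool) (x y : Fin n → Bool) : Bool :=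
  g fun i => x i && y i

open Finset

/-- The sign `±1` of a bit. -/
def boolSign (b : Bool) : ℝ := if b then 1 else -1

theorem CommProtocol.exists_rectangle_partition {X Y : Type*} (P : CommProtocol X Y) :
    ∃ (L : Type) (_ : Fintype L) (A : L → X → ℝ) (B : L → Y → ℝ) (o : L → Bool),
      Fintype.card L ≤ 2 ^ P.cost ∧ (∀ l x, 0 ≤ A l x ∧ A l x ≤ 1) ∧
      (∀ l y, 0 ≤ B l y ∧ B l y ≤ 1) ∧ (∀ x y, ∑ l, A l x * B l y = 1) ∧
      ∀ x y b, ∑ l, (if o l = b then A l x * B l y else 0) =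
        if P.eval x y = b then 1 else 0 := by
  induction P with
  | leaf b =>
    exact ⟨Unit, inferInstance, fun _ _ => 1, fun _ _ => 1, fun _ => b, by simp [cost],
      by simp, by simp, by simp, fun x y b' => by
        by_cases h : b = b' <;> simp [eval, h]⟩
  | alice a P Q ihP ihQ =>
    obtain ⟨L₁, _, A₁, B₁, o₁, hc₁, hA₁, hB₁, hs₁, ho₁⟩ := ihP
    obtain ⟨L₂, _, A₂, B₂, o₂, hc₂, hA₂, hB₂, hs₂, ho₂⟩ := ihQ
    refine ⟨L₁ ⊕ L₂, inferInstance,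
      Sum.elim (fun l x => if a x then A₁ l x else 0) (fun l x => if a x then 0 else A₂ l x),
      Sum.elim B₁ B₂, Sum.elim o₁ o₂, ?_, ?_, ?_, ?_, ?_⟩
    · have h₁ := Nat.pow_le_pow_right (n := 2) (by norm_num) (le_max_left P.cost Q.cost)
      have h₂ := Nat.pow_le_pow_right (n := 2) (by norm_num) (le_max_right P.cost Q.cost)
      simp only [Fintype.card_sum, cost, pow_succ]
      omega
    · rintro (l | l) x <;> by_cases h : a x = true <;> simp [h, hA₁, hA₂]
    · rintro (l | l) y <;> simp [hB₁, hB₂]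
    · intro x y
      by_cases h : a x = true <;> simp [h, hs₁, hs₂]
    · intro x y b
      by_cases h : a x = true <;> simp [h, ho₁, ho₂, eval]
  | bob a P Q ihP ihQ =>
    obtain ⟨L₁, _, A₁, B₁, o₁, hc₁, hA₁, hB₁, hs₁, ho₁⟩ := ihP
    obtain ⟨L₂, _, A₂, B₂, o₂, hc₂, hA₂, hB₂, hs₂, ho₂⟩ := ihQ
    refine ⟨L₁ ⊕ L₂, inferInstance, Sum.elim A₁ A₂,
      Sum.elim (fun l y => if a y then B₁ l y else 0) (fun l y => if a y then 0 else B₂ l y),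
      Sum.elim o₁ o₂, ?_, ?_, ?_, ?_, ?_⟩
    · have h₁ := Nat.pow_le_pow_right (n := 2) (by norm_num) (le_max_left P.cost Q.cost)
      have h₂ := Nat.pow_le_pow_right (n := 2) (by norm_num) (le_max_right P.cost Q.cost)
      simp only [Fintype.card_sum, cost, pow_succ]
      omega
    · rintro (l | l) x <;> simp [hA₁, hA₂]
    · rintro (l | l) y <;> by_cases h : a y = true <;> simp [h, hB₁, hB₂]
    · intro x y
      by_cases h : a y = true <;> simp [h, hs₁, hs₂]
    · intro x y b
      by_cases h : a y = true <;> simp [h, ho₁, ho₂, eval]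

section Analytic

variable {ι : Type*} [Fintype ι] [DecidableEq ι]

theorem sum_exp_sum_mul_boolSign_le (v : ι → ℝ) :
    ∑ x : ι → Bool, Real.exp (∑ i, v i * boolSign (x i)) ≤
      2 ^ Fintype.card ι * Real.exp ((∑ i, v i ^ 2) / 2) := by
  have h : ∑ x : ι → Bool, Real.exp (∑ i, v i * boolSign (x i)) =
      ∏ i, ∑ b : Bool, Real.exp (v i * boolSign b) := by
    rw [Finset.prod_univ_sum, Fintype.piFinset_univ]
    simp [Real.exp_sum]
  rw [h, sum_div, Real.exp_sum, ← card_univ, ← prod_const, ← prod_mul_distrib]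
  refine prod_le_prod (fun i _ => sum_nonneg fun _ _ => (Real.exp_pos _).le) fun i _ => ?_
  have := Real.cosh_le_exp_half_sq (v i)
  rw [Real.cosh_eq] at this
  simp only [boolSign, Fintype.sum_bool, if_true, Bool.false_eq_true, if_false, mul_one, mul_neg]
  linarith

/-- Chang's level-one inequality for densities on the discrete cube. -/
theorem level_one_inequality (A : (ι → Bool) → ℝ) (hA : ∀ x, 0 ≤ A x ∧ A x ≤ 1)
    (hM : 0 < ∑ x, A x) :
    ∑ i, ((∑ x, A x * boolSign (x i)) / ∑ x, A x) ^ 2 ≤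
      2 * Real.log (2 ^ Fintype.card ι / ∑ x, A x) := by
  set M := ∑ x, A x with hMdef
  set v : ι → ℝ := fun i => (∑ x, A x * boolSign (x i)) / M with hv
  have hmean : ∑ x, (A x / M) • (∑ i, v i * boolSign (x i)) = ∑ i, v i ^ 2 := by
    simp only [smul_eq_mul, mul_sum]
    rw [sum_comm]
    refine sum_congr rfl fun i _ => ?_
    rw [pow_two]
    change _ = v i * ((∑ x, A x * boolSign (x i)) / M)
    rw [sum_div, mul_sum]
    exact sum_congr rfl fun x _ => by ring
  have hJ := convexOn_exp.map_sum_le (t := univ) (w := fun x => A x / M)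
    (p := fun x => ∑ i, v i * boolSign (x i)) (fun x _ => div_nonneg (hA x).1 hM.le)
    (by rw [← sum_div, div_self hM.ne']) (fun _ _ => Set.mem_univ _)
  rw [hmean] at hJ
  have h1 : ∑ x, (A x / M) • Real.exp (∑ i, v i * boolSign (x i)) ≤
      (2 ^ Fintype.card ι / M) * Real.exp ((∑ i, v i ^ 2) / 2) := by
    rw [div_mul_eq_mul_div, le_div_iff₀ hM, sum_mul]
    refine le_trans (sum_le_sum fun x _ => ?_) (sum_exp_sum_mul_boolSign_le v)
    rw [smul_eq_mul, mul_right_comm, div_mul_cancel₀ _ hM.ne']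
    exact mul_le_of_le_one_left (Real.exp_pos _).le (hA x).2
  have h2 := Real.log_le_log (Real.exp_pos _) (hJ.trans h1)
  rw [Real.log_exp, Real.log_mul (by positivity) (Real.exp_pos _).ne', Real.log_exp] at h2
  change ∑ i, v i ^ 2 ≤ _
  linarith

end Analytic

theorem sum_mul_log_inv_le_log_card {L : Type*} [Fintype L] (w : L → ℝ) (hw : ∀ l, 0 ≤ w l)
    (hs : ∑ l, w l = 1) : ∑ l, w l * Real.log (w l)⁻¹ ≤ Real.log (Fintype.card L) := by
  have hL : 0 < (Fintype.card L : ℝ) := by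
    have : Nonempty L := by
      by_contra h
      rw [not_nonempty_iff] at h
      simp at hs
    exact_mod_cast Fintype.card_pos
  have key : ∀ l, w l * Real.log (w l)⁻¹ ≤
      w l * Real.log (Fintype.card L) + ((Fintype.card L : ℝ)⁻¹ - w l) := by
    intro l
    rcases (hw l).eq_or_lt with h | h
    · rw [← h]; simp
    · have := Real.log_le_sub_one_of_pos (x := (w l)⁻¹ * (Fintype.card L : ℝ)⁻¹) (by positivity)
      rw [Real.log_mul (by positivity) (by positivity), Real.log_inv (Fintype.card L : ℝ)] at this
      have h3 := mul_le_mul_of_nonneg_left this h.le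
      have h4 : w l * ((w l)⁻¹ * (Fintype.card L : ℝ)⁻¹ - 1) = (Fintype.card L : ℝ)⁻¹ - w l := by
        field_simp
      linarith
  refine (sum_le_sum fun l _ => key l).trans ?_
  rw [sum_add_distrib, sum_sub_distrib, ← sum_mul, hs]
  simp [hL.ne']

/-- The Hellinger cut-and-paste bound for the two-bit AND, in terms of rectangle masses. -/
theorem hellinger_cut_and_paste {L : Type*} [Fintype L] (α β : Bool → L → ℝ) (T : ℝ)
    (hα : ∀ u l, 0 ≤ α u l) (hβ : ∀ u l, 0 ≤ β u l) (hT : ∀ u v, ∑ l, α u l * β v l = T)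
    (o : L → Prop) [DecidablePred o] :
    ∑ l, (if o l then α true l * β true l - 3 / 2 * (α false l * β false l) else 0) ≤
      6 * ∑ l, (β false l * (α true l - α false l) ^ 2 / (α true l + α false l) +
        α false l * (β true l - β false l) ^ 2 / (β true l + β false l)) := by
  have hdiff : ∀ a b : ℝ, 0 ≤ a → 0 ≤ b → (√a - √b) ^ 2 ≤ (a - b) ^ 2 / (a + b) := by
    intro a b ha hb
    rcases (add_nonneg ha hb).eq_or_lt with h | h
    · have ha0 : a = 0 := by linarith
      have hb0 : b = 0 := by linarith
      simp [ha0, hb0]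
    · rw [le_div_iff₀ h]
      obtain ⟨s, hs, rfl⟩ : ∃ s, 0 ≤ s ∧ s ^ 2 = a := ⟨√a, Real.sqrt_nonneg a, Real.sq_sqrt ha⟩
      obtain ⟨t, ht, rfl⟩ : ∃ t, 0 ≤ t ∧ t ^ 2 = b := ⟨√b, Real.sqrt_nonneg b, Real.sq_sqrt hb⟩
      rw [Real.sqrt_sq hs, Real.sqrt_sq ht]
      have : (s ^ 2 - t ^ 2) ^ 2 - (s - t) ^ 2 * (s ^ 2 + t ^ 2) = 2 * s * t * (s - t) ^ 2 := by
        ring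
      nlinarith [mul_nonneg (mul_nonneg hs ht) (sq_nonneg (s - t))]
  have hpaste : ∑ l, (√(α true l * β true l) - √(α false l * β false l)) ^ 2 =
      ∑ l, (√(α true l * β false l) - √(α false l * β true l)) ^ 2 := by
    have hexp : ∀ u v l, (√(α true l * β u l) - √(α false l * β v l)) ^ 2 =
        α true l * β u l + α false l * β v l -
          2 * (√(α true l) * √(β u l) * √(α false l) * √(β v l)) := by
      intro u v l
      rw [sub_sq, Real.sq_sqrt (mul_nonneg (hα _ _) (hβ _ _)),
        Real.sq_sqrt (mul_nonneg (hα _ _) (hβ _ _)), Real.sqrt_mul (hα _ _),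
        Real.sqrt_mul (hα _ _)]
      ring
    simp only [hexp, sum_sub_distrib, sum_add_distrib, hT]
    congr 1
    exact sum_congr rfl fun l _ => by ring
  calc ∑ l, (if o l then α true l * β true l - 3 / 2 * (α false l * β false l) else 0)
      ≤ ∑ l, 3 * (√(α true l * β true l) - √(α false l * β false l)) ^ 2 := by
        refine sum_le_sum fun l _ => ?_
        split_ifs
        · have h1 := Real.sq_sqrt (mul_nonneg (hα true l) (hβ true l))
          have h2 := Real.sq_sqrt (mul_nonneg (hα false l) (hβ false l))
          nlinarith [sq_nonneg (2 * √(α true l * β true l) - 3 * √(α false l * β false l))]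
        · positivity
    _ = 3 * ∑ l, (√(α true l * β false l) - √(α false l * β true l)) ^ 2 := by
        rw [← mul_sum, hpaste]
    _ ≤ 3 * ∑ l, 2 * (β false l * (√(α true l) - √(α false l)) ^ 2 +
          α false l * (√(β true l) - √(β false l)) ^ 2) := by
        refine mul_le_mul_of_nonneg_left (sum_le_sum fun l _ => ?_) (by norm_num)
        have h1 : β false l * (√(α true l) - √(α false l)) ^ 2 =
            (√(β false l) * (√(α true l) - √(α false l))) ^ 2 := by
          rw [mul_pow, Real.sq_sqrt (hβ _ _)]
        have h2 : α false l * (√(β true l) - √(β false l)) ^ 2 =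
            (√(α false l) * (√(β true l) - √(β false l))) ^ 2 := by
          rw [mul_pow, Real.sq_sqrt (hα _ _)]
        rw [Real.sqrt_mul (hα _ _), Real.sqrt_mul (hα _ _), h1, h2]
        nlinarith [sq_nonneg (√(β false l) * (√(α true l) - √(α false l)) +
          √(α false l) * (√(β true l) - √(β false l)))]
    _ ≤ _ := by
        rw [← mul_sum, ← mul_assoc]
        norm_num
        refine sum_le_sum fun l _ => ?_
        rw [mul_div_assoc, mul_div_assoc]
        exact add_le_add (mul_le_mul_of_nonneg_left (hdiff _ _ (hα _ _) (hα _ _)) (hβ _ _))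
          (mul_le_mul_of_nonneg_left (hdiff _ _ (hβ _ _) (hβ _ _)) (hα _ _))

section Mask

variable {ι : Type*} [DecidableEq ι]

/-- The input with bit `u` at `i` that agrees with `x` on the other positions where the mask `d`
is `true`, and is `false` elsewhere. -/
def maskedInput (d x : ι → Bool) (i : ι) (u : Bool) : ι → Bool :=
  Function.update (fun j => d j && x j) i u

theorem and_update_true (d x : ι → Bool) (i : ι) (u : Bool) :
    (fun j => Function.update d i true j && Function.update x i u j) = maskedInput d x i u := by
  ext j
  by_cases h : j = i
  · subst h; simp [maskedInput]
  · simp [maskedInput, h]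

theorem and_update_false (d x : ι → Bool) (i : ι) :
    (fun j => Function.update d i false j && x j) = maskedInput d x i false := by
  ext j
  by_cases h : j = i
  · subst h; simp [maskedInput]
  · simp [maskedInput, h]

theorem not_update (d : ι → Bool) (i : ι) (u : Bool) :
    (fun j => !Function.update d i u j) = Function.update (fun j => !d j) i (!u) := by
  ext j
  by_cases h : j = i
  · subst h; simp
  · simp [h]

end Mask

section Cube

variable {ι : Type*} [Fintype ι] [DecidableEq ι]

theorem sum_update_true_add_sum_update_false (i : ι) (G : (ι → Bool) → ℝ) :
    ∑ x, G (Function.update x i true) + ∑ x, G (Function.update x i false) =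
      2 * ∑ x, G x := by
  have hinv : Function.Involutive fun x : ι → Bool => Function.update x i (!x i) := by
    intro x
    simp
  have hflip : ∑ x, G (Function.update x i (!x i)) = ∑ x, G x :=
    Equiv.sum_comp (Function.Involutive.toPerm _ hinv) G
  rw [two_mul]
  nth_rewrite 1 [← hflip]
  rw [← sum_add_distrib, ← sum_add_distrib]
  refine sum_congr rfl fun x _ => ?_
  have hx : Function.update x i (x i) = x := Function.update_eq_self i x
  cases h : x i <;> rw [h] at hx <;> simp [hx, add_comm]

/-- The unnormalized mean of a function on the cube. -/
def cubeSum (A : (ι → Bool) → ℝ) : ℝ := ∑ x, A x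

/-- The unnormalized degree-one Fourier coefficient of a function on the cube. -/
def cubeBias (A : (ι → Bool) → ℝ) (i : ι) : ℝ := ∑ x, A x * boolSign (x i)

theorem sum_bias_sq_le {L : Type*} [Fintype L] (A B : L → (ι → Bool) → ℝ)
    (hA : ∀ l x, 0 ≤ A l x ∧ A l x ≤ 1) (hB : ∀ l y, 0 ≤ B l y ∧ B l y ≤ 1)
    (hs : ∀ x y, ∑ l, A l x * B l y = 1) :
    ∑ i, ∑ l, (cubeSum (B l) * cubeBias (A l) i ^ 2 / cubeSum (A l) +
        cubeSum (A l) * cubeBias (B l) i ^ 2 / cubeSum (B l)) ≤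
      4 ^ Fintype.card ι * (2 * Real.log (Fintype.card L)) := by
  set T : ℝ := 2 ^ Fintype.card ι with hTdef
  have hT : 0 < T := by positivity
  have hT2 : (4 : ℝ) ^ Fintype.card ι = T * T := by
    rw [hTdef, ← mul_pow]; norm_num
  have hMA : ∀ l, 0 ≤ cubeSum (A l) := fun l => sum_nonneg fun x _ => (hA l x).1
  have hMB : ∀ l, 0 ≤ cubeSum (B l) := fun l => sum_nonneg fun x _ => (hB l x).1
  have hbias : ∀ C : (ι → Bool) → ℝ, (∀ x, 0 ≤ C x) → cubeSum C = 0 → ∀ i, cubeBias C i = 0 := by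
    intro C hC h i
    have h0 := (sum_eq_zero_iff_of_nonneg fun x _ => hC x).1 h
    exact sum_eq_zero fun x hx => by rw [h0 x hx, zero_mul]
  set w : L → ℝ := fun l => cubeSum (A l) * cubeSum (B l) / (T * T) with hw
  have hw0 : ∀ l, 0 ≤ w l := fun l => by
    have := hMA l; have := hMB l; positivity
  have hw1 : ∑ l, w l = 1 := by
    rw [← sum_div, div_eq_one_iff_eq (by positivity)]
    simp only [cubeSum, sum_mul_sum]
    rw [sum_comm]
    simp_rw [sum_comm (s := (univ : Finset L)), hs]
    simp [hTdef]
  rw [sum_comm, hT2, mul_left_comm]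
  refine le_trans ?_ (mul_le_mul_of_nonneg_left (mul_le_mul_of_nonneg_left
    (sum_mul_log_inv_le_log_card w hw0 hw1) (by positivity : 0 ≤ T * T)) (by norm_num : (0:ℝ) ≤ 2))
  rw [mul_sum, mul_sum]
  refine sum_le_sum fun l _ => ?_
  rcases (hMA l).eq_or_lt with ha | ha
  · simp [hw, ← ha]
  rcases (hMB l).eq_or_lt with hb | hb
  · simp [hw, ← hb]
  have h1 := level_one_inequality (A l) (hA l) ha
  have h2 := level_one_inequality (B l) (hB l) hb
  have h3 : Real.log (w l)⁻¹ = Real.log (T / cubeSum (A l)) + Real.log (T / cubeSum (B l)) := by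
    rw [← Real.log_mul (by positivity) (by positivity)]
    congr 1
    simp only [hw]
    field_simp
  have h4 : ∑ i, (cubeSum (B l) * cubeBias (A l) i ^ 2 / cubeSum (A l) +
      cubeSum (A l) * cubeBias (B l) i ^ 2 / cubeSum (B l)) =
      cubeSum (A l) * cubeSum (B l) * (∑ i, (cubeBias (A l) i / cubeSum (A l)) ^ 2 +
        ∑ i, (cubeBias (B l) i / cubeSum (B l)) ^ 2) := by
    rw [← sum_add_distrib, mul_sum]
    refine sum_congr rfl fun i _ => ?_
    field_simp
  have h5 : 2 * (T * T * (w l * Real.log (w l)⁻¹)) = cubeSum (A l) * cubeSum (B l) *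
      (2 * Real.log (T / cubeSum (A l)) + 2 * Real.log (T / cubeSum (B l))) := by
    rw [h3]
    simp only [hw]
    field_simp
  rw [h4, h5]
  exact mul_le_mul_of_nonneg_left (add_le_add h1 h2) (by positivity)

theorem cubeSum_mask_update_true (C : (ι → Bool) → ℝ) (d : ι → Bool) (i : ι) :
    cubeSum (fun x => C fun j => Function.update d i true j && x j) =
      (∑ x, C (maskedInput d x i true) + ∑ x, C (maskedInput d x i false)) / 2 := by
  have := sum_update_true_add_sum_update_false i
    fun x => C fun j => Function.update d i true j && x j
  simp only [and_update_true] at this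
  rw [this, cubeSum]
  ring

theorem cubeBias_mask_update_true (C : (ι → Bool) → ℝ) (d : ι → Bool) (i : ι) :
    cubeBias (fun x => C fun j => Function.update d i true j && x j) i =
      (∑ x, C (maskedInput d x i true) - ∑ x, C (maskedInput d x i false)) / 2 := by
  have := sum_update_true_add_sum_update_false i
    fun x => (C fun j => Function.update d i true j && x j) * boolSign (x i)
  simp only [and_update_true, Function.update_self, boolSign, if_true, Bool.false_eq_true,
    if_false, mul_one, mul_neg, sum_neg_distrib] at this
  simp only [cubeBias, boolSign]
  linarith

theorem cubeSum_mask_update_false (C : (ι → Bool) → ℝ) (d : ι → Bool) (i : ι) :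
    cubeSum (fun x => C fun j => Function.update d i false j && x j) =
      ∑ x, C (maskedInput d x i false) := by
  simp only [cubeSum, and_update_false]

/-- Every deterministic protocol of small cost accepts random uniquely intersecting inputs
hardly more often than random disjoint ones. -/
theorem CommProtocol.unique_disjointness_bound (P : CommProtocol (ι → Bool) (ι → Bool))
    (b : Bool) :
    ∑ i, ∑ d : ι → Bool, ∑ x, ∑ y,
      ((if P.eval (maskedInput d x i true) (maskedInput (fun j => !d j) y i true) = b
          then (1 : ℝ) else 0) - 3 / 2 *
        (if P.eval (maskedInput d x i false) (maskedInput (fun j => !d j) y i false) = b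
          then (1 : ℝ) else 0)) ≤ 24 * (8 ^ Fintype.card ι * (2 * (P.cost * Real.log 2))) := by
  obtain ⟨L, _, A, B, o, hc, hA, hB, hs, ho⟩ := P.exists_rectangle_partition
  set Ad : (ι → Bool) → L → (ι → Bool) → ℝ := fun d l x => A l fun j => d j && x j with hAd
  set Bd : (ι → Bool) → L → (ι → Bool) → ℝ := fun d l y => B l fun j => !d j && y j with hBd
  set F : ι → (ι → Bool) → ℝ := fun i d =>
    ∑ l, (cubeSum (Bd d l) * cubeBias (Ad d l) i ^ 2 / cubeSum (Ad d l) +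
      cubeSum (Ad d l) * cubeBias (Bd d l) i ^ 2 / cubeSum (Bd d l)) with hF
  have hL : 0 < Fintype.card L := by
    by_contra h
    have : IsEmpty L := Fintype.card_eq_zero_iff.1 (by omega)
    simpa using hs (fun _ => true) (fun _ => true)
  have hlog : Real.log (Fintype.card L) ≤ P.cost * Real.log 2 := by
    rw [← Real.log_pow]
    exact Real.log_le_log (by exact_mod_cast hL) (by exact_mod_cast hc)
  have hsumF : ∑ i, ∑ d, F i d ≤ 8 ^ Fintype.card ι * (2 * (P.cost * Real.log 2)) := by
    rw [sum_comm]
    calc ∑ d, ∑ i, F i d ≤ ∑ d : ι → Bool, 4 ^ Fintype.card ι * (2 * (P.cost * Real.log 2)) :=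
          sum_le_sum fun d _ => (sum_bias_sq_le (Ad d) (Bd d) (fun _ _ => hA _ _)
            (fun _ _ => hB _ _) (fun _ _ => hs _ _)).trans (by gcongr)
      _ = _ := by
          rw [sum_const, nsmul_eq_mul, ← mul_assoc]
          congr 1
          simp only [card_univ, Fintype.card_pi, Fintype.card_bool, prod_const, Nat.cast_pow]
          rw [← mul_pow]
          norm_num
  refine le_trans ?_ (mul_le_mul_of_nonneg_left hsumF (by norm_num))
  rw [mul_sum]
  refine sum_le_sum fun i _ => ?_
  have hFd : 24 * ∑ d, F i d =
      ∑ d, 12 * (F i (Function.update d i true) + F i (Function.update d i false)) := by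
    rw [← mul_sum, sum_add_distrib, sum_update_true_add_sum_update_false i (F i)]
    ring
  rw [hFd]
  refine sum_le_sum fun d _ => ?_
  set α : Bool → L → ℝ := fun u l => ∑ x, A l (maskedInput d x i u) with hα
  set β : Bool → L → ℝ := fun v l => ∑ y, B l (maskedInput (fun j => !d j) y i v) with hβ
  have hα0 : ∀ u l, 0 ≤ α u l := fun u l => sum_nonneg fun x _ => (hA l _).1
  have hβ0 : ∀ u l, 0 ≤ β u l := fun u l => sum_nonneg fun x _ => (hB l _).1
  have hprod : ∀ (c : L → ℝ) u v, ∑ l, c l * (α u l * β v l) = ∑ x, ∑ y, ∑ l,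
      c l * (A l (maskedInput d x i u) * B l (maskedInput (fun j => !d j) y i v)) := by
    intro c u v
    have hexpand : ∀ l, α u l * β v l =
        ∑ x, ∑ y, A l (maskedInput d x i u) * B l (maskedInput (fun j => !d j) y i v) :=
      fun l => sum_mul_sum ..
    simp only [hexpand, mul_sum]
    rw [sum_comm]
    exact sum_congr rfl fun x _ => sum_comm
  have hT : ∀ u v, ∑ l, α u l * β v l = 4 ^ Fintype.card ι := by
    intro u v
    have := hprod (fun _ => 1) u v
    simp only [one_mul, hs] at this
    rw [this]
    simp only [sum_const, card_univ, Fintype.card_pi, Fintype.card_bool, prod_const,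
      nsmul_eq_mul, Nat.cast_pow, mul_one]
    rw [← mul_pow]
    norm_num
  have hcount : ∀ u, ∑ x, ∑ y,
      (if P.eval (maskedInput d x i u) (maskedInput (fun j => !d j) y i u) = b
        then (1 : ℝ) else 0) = ∑ l, (if o l = b then α u l * β u l else 0) := by
    intro u
    have := hprod (fun l => if o l = b then 1 else 0) u u
    simp only [ite_mul, one_mul, zero_mul, ho] at this
    exact this.symm
  have hell := hellinger_cut_and_paste α β _ hα0 hβ0 hT (fun l => o l = b)
  have hleft : ∑ x, ∑ y,
      ((if P.eval (maskedInput d x i true) (maskedInput (fun j => !d j) y i true) = b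
          then (1 : ℝ) else 0) - 3 / 2 *
        (if P.eval (maskedInput d x i false) (maskedInput (fun j => !d j) y i false) = b
          then (1 : ℝ) else 0)) =
      ∑ l, (if o l = b then α true l * β true l - 3 / 2 * (α false l * β false l) else 0) := by
    simp only [sum_sub_distrib, ← mul_sum, hcount]
    rw [mul_sum, ← sum_sub_distrib]
    refine sum_congr rfl fun l _ => ?_
    split_ifs <;> simp
  rw [hleft]
  refine hell.trans ?_
  rw [(by norm_num : (12 : ℝ) = 6 * 2), mul_assoc]
  refine mul_le_mul_of_nonneg_left ?_ (by norm_num)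
  rw [← sum_add_distrib, mul_sum]
  refine sum_le_sum fun l _ => ?_
  have nonneg : ∀ (C : (ι → Bool) → ℝ), (∀ x, 0 ≤ C x) → 0 ≤ cubeSum C :=
    fun C h => sum_nonneg fun x _ => h x
  have hAd0 : ∀ e, 0 ≤ cubeSum (Ad e l) := fun e => nonneg _ fun x => (hA l _).1
  have hBd0 : ∀ e, 0 ≤ cubeSum (Bd e l) := fun e => nonneg _ fun x => (hB l _).1
  have hBneg : ∀ u, Bd (Function.update d i u) l =
      fun y => B l fun j => Function.update (fun j => !d j) i (!u) j && y j := by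
    intro u
    funext y
    simp only [hBd, ← not_update]
  have hAt : cubeSum (Ad (Function.update d i true) l) = (α true l + α false l) / 2 :=
    cubeSum_mask_update_true (A l) d i
  have hAt' : cubeBias (Ad (Function.update d i true) l) i = (α true l - α false l) / 2 :=
    cubeBias_mask_update_true (A l) d i
  have hAf : cubeSum (Ad (Function.update d i false) l) = α false l :=
    cubeSum_mask_update_false (A l) d i
  have hBf : cubeSum (Bd (Function.update d i false) l) = (β true l + β false l) / 2 := by
    rw [hBneg]; exact cubeSum_mask_update_true (B l) _ i
  have hBf' : cubeBias (Bd (Function.update d i false) l) i = (β true l - β false l) / 2 := by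
    rw [hBneg]; exact cubeBias_mask_update_true (B l) _ i
  have hBt : cubeSum (Bd (Function.update d i true) l) = β false l := by
    rw [hBneg]; exact cubeSum_mask_update_false (B l) _ i
  have hhalf : ∀ p q r : ℝ,
      p * ((q - r) / 2) ^ 2 / ((q + r) / 2) = p * (q - r) ^ 2 / (q + r) / 2 := by
    intro p q r
    rw [div_div_eq_mul_div, div_pow]
    ring
  have hdrop₁ : 0 ≤ cubeSum (Ad (Function.update d i true) l) *
      cubeBias (Bd (Function.update d i true) l) i ^ 2 /
        cubeSum (Bd (Function.update d i true) l) := by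
    have := hAd0 (Function.update d i true)
    have := hBd0 (Function.update d i true)
    positivity
  have hdrop₂ : 0 ≤ cubeSum (Bd (Function.update d i false) l) *
      cubeBias (Ad (Function.update d i false) l) i ^ 2 /
        cubeSum (Ad (Function.update d i false) l) := by
    have := hAd0 (Function.update d i false)
    have := hBd0 (Function.update d i false)
    positivity
  have h₁ := hhalf (β false l) (α true l) (α false l)
  have h₂ := hhalf (α false l) (β true l) (β false l)
  rw [hAt, hBt] at hdrop₁
  rw [hAf, hBf] at hdrop₂
  rw [hAt, hAt', hAf, hBf, hBf', hBt, h₁, h₂]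
  linarith

end Cube

/-- The protocol obtained by applying maps to the inputs first. -/
def CommProtocol.comap {X Y X' Y' : Type*} (φ : X' → X) (ψ : Y' → Y) :
    CommProtocol X Y → CommProtocol X' Y'
  | leaf b => leaf b
  | alice a P Q => alice (a ∘ φ) (P.comap φ ψ) (Q.comap φ ψ)
  | bob b P Q => bob (b ∘ ψ) (P.comap φ ψ) (Q.comap φ ψ)

theorem CommProtocol.eval_comap {X Y X' Y' : Type*} (φ : X' → X) (ψ : Y' → Y)
    (P : CommProtocol X Y) (x : X') (y : Y') : (P.comap φ ψ).eval x y = P.eval (φ x) (ψ y) := by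
  induction P with
  | leaf b => rfl
  | alice a P Q ihP ihQ => simp [comap, eval, ihP, ihQ]
  | bob b P Q ihP ihQ => simp [comap, eval, ihP, ihQ]

theorem CommProtocol.cost_comap {X Y X' Y' : Type*} (φ : X' → X) (ψ : Y' → Y)
    (P : CommProtocol X Y) : (P.comap φ ψ).cost = P.cost := by
  induction P with
  | leaf b => rfl
  | alice a P Q ihP ihQ => simp [comap, cost, ihP, ihQ]
  | bob b P Q ihP ihQ => simp [comap, cost, ihP, ihQ]

theorem PMF.hasSum_toReal {α : Type*} (μ : PMF α) : HasSum (fun a => (μ a).toReal) 1 := by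
  have := ENNReal.hasSum_toReal (f := fun a => μ a) (by rw [μ.tsum_coe]; simp)
  rwa [← ENNReal.tsum_toReal_eq fun a => μ.apply_ne_top a, μ.tsum_coe, ENNReal.toReal_one] at this

theorem PMF.hasSum_map_toReal {α β : Type*} [DecidableEq β] (μ : PMF α) (g : α → β) (b : β) :
    HasSum (fun a => (μ a).toReal * if g a = b then 1 else 0) ((μ.map g) b).toReal := by
  have htop : ∑' a, (if b = g a then μ a else 0) ≠ ⊤ := by
    have := (μ.map g).apply_ne_top b
    rw [PMF.map_apply] at this
    convert this
  have := ENNReal.hasSum_toReal htop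
  rw [PMF.map_apply]
  convert this using 1
  · funext a
    by_cases h : g a = b
    · simp [h]
    · simp [h, Ne.symm h]
  · rw [ENNReal.tsum_toReal_eq fun a => by split_ifs <;> simp [μ.apply_ne_top]]
    congr 1
    funext a
    congr

theorem maskedInput_and_maskedInput {ι : Type*} [DecidableEq ι] (d x y : ι → Bool) (i j : ι)
    (u : Bool) : (maskedInput d x i u j && maskedInput (fun j => !d j) y i u j) =
      (decide (j = i) && u) := by
  by_cases h : j = i
  · subst h; simp [maskedInput]
  · cases hd : d j <;> simp [maskedInput, h, hd]

/-- The linear lower bound for unique disjointness: a public-coin protocol that separates disjoint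
from uniquely intersecting sets has linear cost. -/
theorem card_le_of_publicCoin_unique_disjointness {ι X Y : Type*} [Fintype ι] [DecidableEq ι]
    {μ : PMF (CommProtocol X Y)} {f : X → Y → Bool} {c : ℕ} (hμ : PublicCoinComputes μ f)
    (hc : PublicCoinCostLE μ c) (φ : (ι → Bool) → X) (ψ : (ι → Bool) → Y) (b : Bool)
    (h1 : ∀ x y i, (∀ j, (x j && y j) = decide (j = i)) → f (φ x) (ψ y) = b)
    (h0 : ∀ x y, (∀ j, (x j && y j) = false) → f (φ x) (ψ y) = !b) :
    (Fintype.card ι : ℝ) ≤ 200 * c := by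
  set q : X → Y → Bool → ℝ := fun x y a => ((μ.map fun P => P.eval x y) a).toReal with hq
  have hqs : ∀ x y a, HasSum (fun P => (μ P).toReal * if P.eval x y = a then 1 else 0) (q x y a) :=
    fun x y a => μ.hasSum_map_toReal _ a
  have hqle : ∀ x y, 2 / 3 ≤ q x y (f x y) := by
    intro x y
    have := ENNReal.toReal_mono (PMF.apply_ne_top _ _) (hμ x y)
    rwa [ENNReal.toReal_div, ENNReal.toReal_ofNat, ENNReal.toReal_ofNat] at this
  have hqadd : ∀ x y a, q x y a + q x y (!a) = 1 := by
    intro x y a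
    refine ((hqs x y a).add (hqs x y (!a))).unique ?_
    convert μ.hasSum_toReal using 2 with P
    cases a <;> cases P.eval x y <;> simp
  set K : ℝ := 24 * (8 ^ Fintype.card ι * (2 * (c * Real.log 2))) with hK
  have hsum : HasSum (fun P => (μ P).toReal * ∑ i, ∑ d : ι → Bool, ∑ x, ∑ y,
      ((if P.eval (φ (maskedInput d x i true)) (ψ (maskedInput (fun j => !d j) y i true)) = b
          then (1 : ℝ) else 0) - 3 / 2 *
        (if P.eval (φ (maskedInput d x i false)) (ψ (maskedInput (fun j => !d j) y i false)) = b
          then (1 : ℝ) else 0)))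
      (∑ i, ∑ d : ι → Bool, ∑ x, ∑ y,
        (q (φ (maskedInput d x i true)) (ψ (maskedInput (fun j => !d j) y i true)) b - 3 / 2 *
          q (φ (maskedInput d x i false)) (ψ (maskedInput (fun j => !d j) y i false)) b)) := by
    simp only [mul_sum, mul_sub, mul_left_comm _ (3 / 2 : ℝ)]
    exact hasSum_sum fun i _ => hasSum_sum fun d _ => hasSum_sum fun x _ => hasSum_sum fun y _ =>
      (hqs _ _ _).sub ((hqs _ _ _).mul_left _)
  have hupper := hasSum_le (fun P => ?_) hsum (μ.hasSum_toReal.mul_right K)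
  · have hlower : ∑ i : ι, ∑ d : ι → Bool, ∑ x : ι → Bool, ∑ y : ι → Bool, (1 / 6 : ℝ) ≤
        1 * K := by
      refine le_trans (sum_le_sum fun i _ => sum_le_sum fun d _ => sum_le_sum fun x _ =>
        sum_le_sum fun y _ => ?_) hupper
      have e1 := h1 (maskedInput d x i true) (maskedInput (fun j => !d j) y i true) i
        fun j => by rw [maskedInput_and_maskedInput, Bool.and_true]
      have e0 := h0 (maskedInput d x i false) (maskedInput (fun j => !d j) y i false)
        fun j => by rw [maskedInput_and_maskedInput, Bool.and_false]
      have l1 := hqle (φ (maskedInput d x i true)) (ψ (maskedInput (fun j => !d j) y i true))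
      have l0 := hqle (φ (maskedInput d x i false)) (ψ (maskedInput (fun j => !d j) y i false))
      rw [e1] at l1
      rw [e0] at l0
      have := hqadd (φ (maskedInput d x i false)) (ψ (maskedInput (fun j => !d j) y i false)) b
      linarith
    have h8 : (2 : ℝ) ^ Fintype.card ι * (2 ^ Fintype.card ι * 2 ^ Fintype.card ι) =
        8 ^ Fintype.card ι := by
      rw [← mul_pow, ← mul_pow]
      norm_num
    simp only [sum_const, card_univ, Fintype.card_pi, Fintype.card_bool, prod_const,
      nsmul_eq_mul, Nat.cast_pow, Nat.cast_ofNat, one_mul] at hlower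
    have h9 : (8 : ℝ) ^ Fintype.card ι * (Fintype.card ι / 6) ≤
        8 ^ Fintype.card ι * (48 * (c * Real.log 2)) := by
      calc (8 : ℝ) ^ Fintype.card ι * (Fintype.card ι / 6) = _ := by rw [← h8]; ring
        _ ≤ K := hlower
        _ = _ := by rw [hK]; ring
    have h10 := le_of_mul_le_mul_left h9 (by positivity)
    have h11 : (c : ℝ) * Real.log 2 ≤ c * 0.6931471808 :=
      mul_le_mul_of_nonneg_left Real.log_two_lt_d9.le (Nat.cast_nonneg c)
    have h12 : (0 : ℝ) ≤ c := Nat.cast_nonneg c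
    linarith
  · by_cases hP : P ∈ μ.support
    · refine mul_le_mul_of_nonneg_left ?_ ENNReal.toReal_nonneg
      have := (P.comap φ ψ).unique_disjointness_bound b
      simp only [CommProtocol.eval_comap, CommProtocol.cost_comap] at this
      refine this.trans ?_
      have hcP : (P.cost : ℝ) ≤ c := by exact_mod_cast hc P hP
      have := Real.log_nonneg (by norm_num : (1 : ℝ) ≤ 2)
      rw [hK]
      gcongr
    · rw [PMF.mem_support_iff, not_not] at hP
      simp [hP]

theorem CommProtocol.exists_cost_le_of_card_le {X Y : Type*} (f : X → Y → Bool) (t : ℕ) :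
    ∀ S : Finset X, #S ≤ 2 ^ t →
      ∃ P : CommProtocol X Y, P.cost ≤ t + 1 ∧ ∀ x ∈ S, ∀ y, P.eval x y = f x y := by
  classical
  induction t with
  | zero =>
    intro S hS
    rcases S.eq_empty_or_nonempty with rfl | ⟨a, ha⟩
    · exact ⟨.leaf true, by simp [cost], by simp⟩
    · refine ⟨.bob (f a) (.leaf true) (.leaf false), by simp [cost], fun x hx y => ?_⟩
      rw [card_le_one.1 (by simpa using hS) x hx a ha]
      cases h : f a y <;> simp [eval, h]
  | succ t ih =>
    intro S hS
    obtain ⟨T, hTS, hT⟩ := exists_subset_card_eq (s := S) (n := min (#S) (2 ^ t)) (min_le_left _ _)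
    obtain ⟨P, hPc, hP⟩ := ih T (hT.trans_le (min_le_right _ _))
    obtain ⟨Q, hQc, hQ⟩ := ih (S \ T) (by
      rw [card_sdiff_of_subset hTS, hT]
      rw [pow_succ] at hS
      omega)
    refine ⟨.alice (fun x => decide (x ∈ T)) P Q, ?_, fun x hx y => ?_⟩
    · simp only [cost]
      omega
    · by_cases h : x ∈ T
      · simpa [eval, h] using hP x h y
      · simpa [eval, h] using hQ x (mem_sdiff.2 ⟨hx, h⟩) y

theorem card_finset_card_le {α : Type*} [Fintype α] [DecidableEq α] (k : ℕ) :
    #{s : Finset α | #s ≤ k} ≤ (Fintype.card α + 1) ^ k := by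
  induction k with
  | zero =>
    have : ({s : Finset α | #s ≤ 0} : Finset (Finset α)) = {∅} := by
      ext s; simp
    rw [this]
    simp
  | succ k ih =>
    have hsub : ({s : Finset α | #s ≤ k + 1} : Finset (Finset α)) ⊆
        image₂ (fun (a : Option α) s => a.elim s (insert · s)) univ {s : Finset α | #s ≤ k} := by
      intro s hs
      rw [mem_filter_univ] at hs
      rw [mem_image₂]
      rcases s.eq_empty_or_nonempty with rfl | ⟨a, ha⟩
      · exact ⟨none, mem_univ _, ∅, by simp, rfl⟩
      · refine ⟨some a, mem_univ _, s.erase a, ?_, by simp [insert_erase ha]⟩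
        rw [mem_filter_univ, card_erase_of_mem ha]
        omega
    calc _ ≤ _ := card_le_card hsub
      _ ≤ _ := card_image₂_le ..
      _ ≤ (Fintype.card α + 1) * (Fintype.card α + 1) ^ k := by
        rw [card_univ, Fintype.card_option]
        exact Nat.mul_le_mul_left _ ih
      _ = _ := by ring

theorem card_hammingWeight_ge {n : ℕ} (w : ℕ) :
    #{x : Fin n → Bool | w ≤ hammingWeight x} ≤ (n + 1) ^ (n - w) := by
  have h := card_finset_card_le (α := Fin n) (n - w)
  rw [Fintype.card_fin] at h
  refine le_trans (card_le_card_of_injOn (fun x => ({i | x i = false} : Finset (Fin n))) ?_ ?_) h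
  · intro x hx
    simp only [coe_filter, mem_univ, true_and, Set.mem_ofPred_eq] at hx ⊢
    have := card_filter_add_card_filter_not (s := (univ : Finset (Fin n))) (fun i => x i = true)
    simp only [card_univ, Fintype.card_fin, Bool.not_eq_true] at this
    rw [hammingWeight] at hx
    omega
  · intro x _ y _ hxy
    funext i
    have := Finset.ext_iff.1 hxy i
    simp only [mem_filter_univ] at this
    cases hx : x i <;> cases hy : y i <;> simp_all

theorem hammingWeight_and_le {n : ℕ} (x y : Fin n → Bool) :
    hammingWeight (fun i => x i && y i) ≤ hammingWeight x := by
  refine card_le_card fun i => ?_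
  simp only [mem_filter_univ, Bool.and_eq_true]
  exact And.left

theorem hammingWeight_le {n : ℕ} (x : Fin n → Bool) : hammingWeight x ≤ n := by
  simpa [hammingWeight] using card_filter_le (univ : Finset (Fin n)) fun i => x i = true

/-- If `g` is constant on inputs of weight below `w`, then Alice may send her zeros. -/
theorem detCC_andFun_le {n : ℕ} (g : (Fin n → Bool) → Bool) (w : ℕ) (b : Bool)
    (hg : ∀ z, hammingWeight z < w → g z = b) :
    detCC (andFun g) ≤ (n - w) * (Nat.log 2 n + 1) + 2 := by
  obtain ⟨P, hPc, hP⟩ := CommProtocol.exists_cost_le_of_card_le (andFun g)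
    ((n - w) * (Nat.log 2 n + 1)) {x : Fin n → Bool | w ≤ hammingWeight x} (by
      refine (card_hammingWeight_ge w).trans ?_
      rw [mul_comm, pow_mul]
      exact Nat.pow_le_pow_left (Nat.lt_pow_succ_log_self (by norm_num) n) _)
  refine Nat.sInf_le ⟨.alice (fun x => decide (w ≤ hammingWeight x)) P (.leaf b), ?_, ?_⟩
  · intro x y
    by_cases h : w ≤ hammingWeight x
    · simpa [CommProtocol.eval, h] using hP x (by simpa using h) y
    · simpa [CommProtocol.eval, h, andFun] using
        (hg _ ((hammingWeight_and_le x y).trans_lt (not_le.1 h))).symm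
  · simp only [CommProtocol.cost]
    omega

/-- The extension of a bit string by ones on the first `m` positions. -/
def extendByOnes {n : ℕ} (m : ℕ) (x : {i : Fin n // ¬ (i : ℕ) < m} → Bool) (i : Fin n) : Bool :=
  if h : (i : ℕ) < m then true else x ⟨i, h⟩

theorem hammingWeight_extendByOnes_and {n m : ℕ} (hm : m ≤ n)
    (x y : {i : Fin n // ¬ (i : ℕ) < m} → Bool) :
    hammingWeight (fun i => extendByOnes m x i && extendByOnes m y i) =
      m + #{i | (x i && y i) = true} := by
  rw [hammingWeight, card_filter, card_filter,
    ← Fintype.sum_subtype_add_sum_subtype (fun i : Fin n => (i : ℕ) < m)]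
  congr 1
  · have h : ∀ i : {i : Fin n // (i : ℕ) < m},
        (if (extendByOnes m x i && extendByOnes m y i) = true then 1 else 0) = 1 := by
      intro i
      simp [extendByOnes, i.2]
    rw [sum_congr rfl fun i _ => h i, sum_const, card_univ, Fintype.card_subtype]
    simp [Fin.card_filter_val_lt, hm]
  · refine sum_congr rfl fun i _ => ?_
    simp [extendByOnes, i.2]

theorem sub_add_one_le_pubRandCC {n : ℕ} (g : (Fin n → Bool) → Bool) (w : ℕ) (hw : w + 1 ≤ n)
    (b : Bool) (h0 : ∀ z, hammingWeight z = w → g z = !b)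
    (h1 : ∀ z, hammingWeight z = w + 1 → g z = b) :
    ((n - w : ℕ) : ℝ) ≤ 200 * pubRandCC (andFun g) := by
  obtain ⟨μ, hμ, hc⟩ := pubRandCC_spec (andFun g)
  have h := card_le_of_publicCoin_unique_disjointness hμ hc
    (extendByOnes (n := n) w) (extendByOnes w) b
    (fun x y i hxy => h1 _ (by
      rw [hammingWeight_extendByOnes_and (by omega)]
      simp [hxy, filter_eq'])) (fun x y hxy => h0 _ (by
      rw [hammingWeight_extendByOnes_and (by omega)]
      simp [hxy]))
  have hcard : Fintype.card {i : Fin n // ¬ (i : ℕ) < w} = n - w := by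
    rw [Fintype.card_subtype_compl, Fintype.card_fin, Fintype.card_subtype]
    simp [Fin.card_filter_val_lt, (by omega : w ≤ n)]
  rwa [hcard] at h

theorem mainTheorem7 :
    ∃ C : ℝ, 0 < C ∧ ∀ n : ℕ, 2 ≤ n → ∀ g : (Fin n → Bool) → Bool, IsSymmetricBoolFun g →
      (detCC (andFun g) : ℝ) ≤ C * ((pubRandCC (andFun g) : ℝ) * Real.logb 2 (n : ℝ)) := by
  refine ⟨400, by norm_num, fun n hn g hg => ?_⟩
  have hlog1 : 1 ≤ Real.logb 2 n := by
    rw [Real.le_logb_iff_rpow_le (by norm_num) (by positivity)]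
    simpa using (by exact_mod_cast hn : (2 : ℝ) ≤ n)
  set z₀ : Fin n → Bool := fun _ => false with hz₀
  by_cases hconst : ∃ w z, hammingWeight z = w ∧ g z ≠ g z₀
  · classical
    obtain ⟨z, hzw, hz⟩ := Nat.find_spec hconst
    have hmin : ∀ z', hammingWeight z' < Nat.find hconst → g z' = g z₀ := by
      intro z' hz'
      by_contra h
      exact Nat.find_min hconst hz' ⟨z', rfl, h⟩
    obtain ⟨w, hw⟩ : ∃ w, Nat.find hconst = w + 1 := by
      refine Nat.exists_eq_succ_of_ne_zero fun h => hz (hg _ _ ?_)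
      rw [hzw, h]
      simp [hammingWeight, hz₀]
    rw [hw] at hzw hmin
    have hwn : w + 1 ≤ n := hzw ▸ hammingWeight_le z
    have hD := detCC_andFun_le g (w + 1) (g z₀) hmin
    have hR := sub_add_one_le_pubRandCC g w hwn (!(g z₀))
      (fun z' hz' => by rw [Bool.not_not]; exact hmin z' (by omega))
      (fun z' hz' => by
        rw [hg z' z (hz'.trans hzw.symm)]
        exact Bool.eq_not_of_ne hz)
    obtain ⟨k, hk⟩ := Nat.exists_eq_add_of_le hwn
    have e1 : n - (w + 1) = k := by omega
    have e2 : n - w = k + 1 := by omega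
    rw [e1] at hD
    rw [e2] at hR
    have hlog := Real.natLog_le_logb n 2
    have hD' : (detCC (andFun g) : ℝ) ≤ k * (Nat.log 2 n + 1) + 2 := by exact_mod_cast hD
    push_cast at hlog hR
    calc (detCC (andFun g) : ℝ) ≤ k * (Nat.log 2 n + 1) + 2 := hD'
      _ ≤ k * (Real.logb 2 n + Real.logb 2 n) + 2 * Real.logb 2 n := by gcongr; linarith
      _ = 2 * ((k + 1) * Real.logb 2 n) := by ring
      _ ≤ 2 * (200 * pubRandCC (andFun g) * Real.logb 2 n) := by gcongr
      _ = _ := by ring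
  · push Not at hconst
    have : detCC (andFun g) ≤ 0 :=
      Nat.sInf_le ⟨.leaf (g z₀), fun x y => (hconst _ _ rfl).symm, le_rfl⟩
    rw [Nat.le_zero.1 this, Nat.cast_zero]
    have : 0 ≤ Real.logb 2 n := by linarith
    positivity
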